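/- Let $k$ be a field and let $A$ be a finite-dimensional symmetric $k$-algebra, i.e. there is a $k$-linear form $t\colon A\to k$ with $t(ab)=t(ba)$ for all $a,b\in A$ such that the bilinear form $(a,b)\mapsto t(ab)$ is nondegenerate. Let $\mathrm{stmod}(A)$ be the stable module category: its objects are the finitely generated left $A$-modules, and its morphism groups $\underline{\mathrm{Hom}}_A(M,N)$ are the $A$-homomorphisms $M\to N$ modulo those that factor through a projective module. For a finitely generated module $M$, let $\Omega M$ be the kernel of an epimorphism from a finitely generated projective module onto $M$, let $\Omega^{-1}M$ be the cokernel of a monomorphism from $M$ into a finitely generated injective module, and let $\Omega^n M$ ($n\in\mathbb Z$) be their iterates, the suspensions of $M$; these are well defined up to isomorphism in $\mathrm{stmod}(A)$. The category $\mathrm{stmod}(A)$ is triangulated, its exact triangles being, up to isomorphism, the triangles $X\to Y\to Z\to\Omega^{-1}X$ arising from short exact sequences $0\to X\to Y\to Z\to 0$. Let $L$ be a finitely generated non-projective indecomposable $A$-module, and let $\mathrm{thick}(L)$ be the smallest full subcategory of $\mathrm{stmod}(A)$ that contains $L$ and is closed under exact triangles (if two objects of an exact triangle lie in it, so does the third)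 and under direct summands. Then the following are equivalent. 1. The functor $\underline{\mathrm{Hom}}_A(\Omega^*L,-)$, $M\mapsto\big(\underline{\mathrm{Hom}}_A(\Omega^nL,M)\big)_{n\in\mathbb Z}$, from $\mathrm{thick}(L)$ to graded abelian groups is faithful. 2. $\mathrm{thick}(L)$ consists of the modules that are isomorphic in $\mathrm{stmod}(A)$ to finite direct sums $\Omega^{n_1}L\oplus\cdots\oplus\Omega^{n_m}L$ with $m\ge 0$ and $n_1,\dots,n_m\in\mathbb Z$. -/

import Mathlib

open CategoryTheory

universe u v

set_option linter.style.haveILetI false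

noncomputable section

namespace StableModule

/-- `A` is a symmetric `k`-algebra: it carries a symmetrizing form, that is a `k`-linear map
`t : A → k` with `t (a * b) = t (b * a)` such that the bilinear form `(a, b) ↦ t (a * b)` is
nondegenerate. (For finite-dimensional `A` this says `A ≅ Hom_k(A, k)` as bimodules.) -/
def IsSymmetricAlg (k : Type u) (A : Type v) [Field k] [Ring A] [Algebra k A] : Prop :=
  ∃ t : A →ₗ[k] k, (∀ a b : A, t (a * b) = t (b * a)) ∧ ∀ a : A, (∀ b : A, t (a * b) = 0) → a = 0

section Stable

variable (A : Type v) [Ring A]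

/-- Two maps of finitely generated modules are identified in the stable category when their
difference factors through a finitely generated projective module. (A map between finitely
generated modules that factors through some projective module factors through a finitely
generated one.) -/
def stableRel : HomRel (FGModuleCat.{v} A) := fun X Y f g =>
  ∃ (P : FGModuleCat.{v} A) (a : X ⟶ P) (b : P ⟶ Y), Module.Projective A P ∧ f - g = a ≫ b

instance stableRel_congruence : Congruence (stableRel A) where
  equivalence {X Y} :=
    { refl := fun f => ⟨FGModuleCat.of A PUnit, 0, 0, inferInstance, by simp⟩
      symm := by
        rintro f g ⟨P, a, b, hP, h⟩
        exact ⟨P, a, -b, hP, by rw [Preadditive.comp_neg, ← h, neg_sub]⟩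
      trans := by
        rintro f g l ⟨P, a, b, hP, h⟩ ⟨P', a', b', hP', h'⟩
        have e : f - l = a ≫ b + a' ≫ b' := by rw [← h, ← h']; abel
        refine ⟨FGModuleCat.of A (P × P'), FGModuleCat.ofHom (a.hom.hom.prod a'.hom.hom),
          FGModuleCat.ofHom (b.hom.hom.coprod b'.hom.hom), ?_, ?_⟩
        · haveI := hP
          haveI := hP'
          exact (inferInstance : Module.Projective A (P × P'))
        · rw [e]
          ext x
          rfl }
  comp_left f _ _ := by
    rintro ⟨P, a, b, hP, h⟩
    exact ⟨P, f ≫ a, b, hP, by rw [← Preadditive.comp_sub, h, Category.assoc]⟩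
  comp_right g := by
    rintro ⟨P, a, b, hP, h⟩
    exact ⟨P, a, b ≫ g, hP, by rw [← Preadditive.sub_comp, h, Category.assoc]⟩

/-- The stable module category `stmod(A)`: its objects are the finitely generated `A`-modules, its
morphisms the module homomorphisms modulo those that factor through a projective module. -/
abbrev StMod : Type (v + 1) := Quotient (stableRel A)

lemma stableRel_add ⦃X Y : FGModuleCat.{v} A⦄ (f₁ f₂ g₁ g₂ : X ⟶ Y)
    (hf : stableRel A f₁ f₂) (hg : stableRel A g₁ g₂) : stableRel A (f₁ + g₁) (f₂ + g₂) := by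
  have h0 : ∀ {x y : X ⟶ Y}, stableRel A x y → ∀ z w : X ⟶ Y, x - y = z - w → stableRel A z w := by
    rintro x y ⟨P, a, b, hP, h⟩ z w e
    exact ⟨P, a, b, hP, by rw [← e, h]⟩
  exact (stableRel_congruence A).equivalence.trans
    (h0 hf (f₁ + g₁) (f₂ + g₁) (by abel)) (h0 hg (f₂ + g₁) (f₂ + g₂) (by abel))

instance : Preadditive (StMod A) := Quotient.preadditive _ (stableRel_add A)

/-- The quotient functor from finitely generated modules to the stable module category. -/
abbrev toStMod : FGModuleCat.{v} A ⥤ StMod A := Quotient.functor (stableRel A)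

end Stable

lemma exists_projective_cover {A : Type v} [Ring A] (X : FGModuleCat.{v} A) :
    ∃ (P : FGModuleCat.{v} A) (p : P ⟶ X), Module.Projective A P ∧
      Function.Surjective p.hom.hom := by
  obtain ⟨n, f, hf⟩ := Module.Finite.exists_fin' A X
  exact ⟨FGModuleCat.of A (Fin n → A), FGModuleCat.ofHom f,
    (inferInstance : Module.Projective A (Fin n → A)), hf⟩

section Coinduced

variable (k : Type u) {A : Type v} [Field k] [Ring A] [Algebra k A]

/-- The action of `A` on the coinduced module `Hom_k(A, V)`, `(b • f) a = f (a * b)`. -/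
@[reducible]
def coinducedModule (V : Type v) [AddCommGroup V] [Module k V] : Module A (A →ₗ[k] V) where
  smul b f := f ∘ₗ LinearMap.mulRight k b
  one_smul f := LinearMap.ext fun a => congrArg f (mul_one a)
  mul_smul b c f := LinearMap.ext fun a => congrArg f (mul_assoc a b c).symm
  smul_zero _ := rfl
  smul_add _ _ _ := rfl
  add_smul b c f := LinearMap.ext fun a => (congrArg f (mul_add a b c)).trans (map_add f _ _)
  zero_smul f := LinearMap.ext fun a => (congrArg f (mul_zero a)).trans (map_zero f)

/-- The coinduced module `Hom_k(A, V)`. -/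
def Coinduced (k : Type u) (A : Type v) [Field k] [Ring A] [Algebra k A] (V : Type v)
    [AddCommGroup V] [Module k V] : Type v := A →ₗ[k] V

instance (V : Type v) [AddCommGroup V] [Module k V] : AddCommGroup (Coinduced k A V) :=
  inferInstanceAs (AddCommGroup (A →ₗ[k] V))

instance (V : Type v) [AddCommGroup V] [Module k V] : Module A (Coinduced k A V) :=
  coinducedModule k V

lemma coinduced_finite [Module.Finite k A] (V : Type v) [AddCommGroup V] [Module k V] [Module.Finite k V] :
    Module.Finite A (Coinduced k A V) := by
  letI : Module k (Coinduced k A V) := inferInstanceAs (Module k (A →ₗ[k] V))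
  haveI : Module.Finite k (Coinduced k A V) := inferInstanceAs (Module.Finite k (A →ₗ[k] V))
  haveI : IsScalarTower k A (Coinduced k A V) := by
    refine ⟨fun c b f => LinearMap.ext fun a => ?_⟩
    change (show A →ₗ[k] V from f) (a * c • b) = c • (show A →ₗ[k] V from f) (a * b)
    rw [mul_smul_comm, map_smul]
  exact Module.Finite.of_restrictScalars_finite k A _

lemma coinduced_injective (V : Type v) [AddCommGroup V] [Module k V] :
    Module.Injective A (Coinduced k A V) := by
  refine ⟨fun {X Y} _ _ _ _ f hf g => ?_⟩
  letI : Module k X := Module.restrictScalars k A X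
  letI : Module k Y := Module.restrictScalars k A Y
  haveI : IsScalarTower k A X := IsScalarTower.restrictScalars k A X
  haveI : IsScalarTower k A Y := IsScalarTower.restrictScalars k A Y
  let ev : X →ₗ[k] V :=
    { toFun := fun x => (show A →ₗ[k] V from g x) 1
      map_add' := fun x y => by rw [map_add]; rfl
      map_smul' := fun c x => by
        rw [← algebraMap_smul A c x, map_smul]
        change (show A →ₗ[k] V from g x) (1 * algebraMap k A c) = _
        rw [one_mul, Algebra.algebraMap_eq_smul_one, map_smul]
        rfl }
  obtain ⟨r, hr⟩ := (f.restrictScalars k).exists_leftInverse_of_injective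
    (LinearMap.ker_eq_bot.mpr hf)
  let h : Y →ₗ[k] V := ev ∘ₗ r
  have hh : ∀ x, h (f x) = ev x := fun x => congrArg ev (LinearMap.congr_fun hr x)
  refine ⟨{ toFun := fun y =>
              (show A →ₗ[k] V from h ∘ₗ (LinearMap.toSpanSingleton A Y y).restrictScalars k)
            map_add' := fun y z => LinearMap.ext fun a => ?_
            map_smul' := fun b y => LinearMap.ext fun a => ?_ }, fun x => LinearMap.ext fun a => ?_⟩
  · change h (a • (y + z)) = h (a • y) + h (a • z)
    rw [smul_add, map_add]
  · change h (a • b • y) = h ((a * b) • y)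
    rw [mul_smul]
  · change h (a • f x) = _
    rw [← map_smul, hh]
    change (show A →ₗ[k] V from g (a • x)) 1 = _
    rw [map_smul]
    change (show A →ₗ[k] V from g x) (1 * a) = _
    rw [one_mul]

end Coinduced

lemma exists_injective_embedding (k : Type u) {A : Type v} [Field k] [Ring A] [Algebra k A]
    [Module.Finite k A] (X : FGModuleCat.{v} A) :
    ∃ (I : FGModuleCat.{v} A) (i : X ⟶ I), Module.Injective A I ∧
      Function.Injective i.hom.hom := by
  letI : Module k X := Module.restrictScalars k A X
  haveI : IsScalarTower k A X := IsScalarTower.restrictScalars k A X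
  haveI : Module.Finite k X := Module.Finite.trans A X
  haveI := coinduced_finite (A := A) k X
  let F : X →ₗ[A] Coinduced k A X :=
    { toFun := fun x => (show A →ₗ[k] X from (LinearMap.toSpanSingleton A X x).restrictScalars k)
      map_add' := fun x y => LinearMap.ext fun a => smul_add a x y
      map_smul' := fun b x => LinearMap.ext fun a => (mul_smul a b x).symm }
  refine ⟨FGModuleCat.of A (Coinduced k A X), FGModuleCat.ofHom F,
    coinduced_injective k X, fun x y hxy => ?_⟩
  have h : (1 : A) • (x : X) = (1 : A) • (y : X) :=
    congrArg (fun f : Coinduced k A X => (show A →ₗ[k] X from f) 1) hxy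
  simpa using h

section Syzygy

variable (k : Type u) {A : Type v} [Field k] [Ring A] [Algebra k A] [Module.Finite k A]

/-- A finitely generated projective module mapping onto `X`. -/
def proj (X : FGModuleCat.{v} A) : FGModuleCat.{v} A := (exists_projective_cover X).choose

/-- The chosen epimorphism from a projective module onto `X`. -/
def projMap (X : FGModuleCat.{v} A) : proj X ⟶ X := (exists_projective_cover X).choose_spec.choose

/-- A finitely generated injective module into which `X` embeds. -/
def inj (X : FGModuleCat.{v} A) : FGModuleCat.{v} A := (exists_injective_embedding k X).choose

/-- The chosen monomorphism from `X` into an injective module. -/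
def injMap (X : FGModuleCat.{v} A) : X ⟶ inj k X :=
  (exists_injective_embedding k X).choose_spec.choose

lemma finite_ker (k : Type u) {A : Type v} [Field k] [Ring A] [Algebra k A] [Module.Finite k A]
    {P X : FGModuleCat.{v} A} (f : P ⟶ X) : Module.Finite A (LinearMap.ker f.hom.hom) := by
  haveI : IsNoetherianRing A := isNoetherian_of_tower k inferInstance
  infer_instance

/-- The syzygy `Ω X`: the kernel of an epimorphism from a finitely generated projective module onto
`X`. In the stable category it does not depend on the choice of the epimorphism. -/
def syzygy (X : FGModuleCat.{v} A) : FGModuleCat.{v} A :=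
  haveI := finite_ker k (projMap X)
  FGModuleCat.of A (LinearMap.ker (projMap X).hom.hom)

/-- The cosyzygy `Ω⁻¹ X`: the cokernel of a monomorphism from `X` into a finitely generated
injective module. Over a self-injective algebra, where injective and projective modules coincide,
it does not depend in the stable category on the choice of the monomorphism. -/
def cosyzygy (X : FGModuleCat.{v} A) : FGModuleCat.{v} A :=
  FGModuleCat.of A (inj k X ⧸ LinearMap.range (injMap k X).hom.hom)

/-- The projection of the injective module containing `X` onto `Ω⁻¹ X`. -/
def cosyzygyMap (X : FGModuleCat.{v} A) : inj k X ⟶ cosyzygy k X :=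
  FGModuleCat.ofHom (LinearMap.range (injMap k X).hom.hom).mkQ

/-- The suspensions `Ω^n X` of `X`, for every integer `n`. -/
def omega : ℤ → FGModuleCat.{v} A → FGModuleCat.{v} A
  | Int.ofNat n => (syzygy k)^[n]
  | Int.negSucc n => (cosyzygy k)^[n + 1]

/-- `0 → X → Y → Z → 0` is a short exact sequence of modules. -/
def IsShortExact {X Y Z : FGModuleCat.{v} A} (i : X ⟶ Y) (p : Y ⟶ Z) : Prop :=
  Function.Injective i.hom.hom ∧ Function.Exact i.hom.hom p.hom.hom ∧ Function.Surjective p.hom.hom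

/-- Exact triangles `X → Y → Z → Ω⁻¹ X` of the stable category. A short exact sequence
`0 → X → Y' → Z' → 0` gives the triangle `X → Y' → Z' → Ω⁻¹ X` whose third map `d` is part of a
map of short exact sequences, the identity on `X`, to `0 → X → inj X → Ω⁻¹ X → 0`. A triangle
is exact when it is isomorphic to one of these, by an isomorphism that is the identity on `X`. (Over
a self-injective algebra every map becomes a monomorphism of modules after adding to its target an
injective module, which is zero in the stable category, so this loses nothing.) The sign convention for the third map plays no role for thick
subcategories. -/
def IsExactTriangle {X Y Z : StMod A} (f : X ⟶ Y) (g : Y ⟶ Z)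
    (h : Z ⟶ (toStMod A).obj (cosyzygy k X.as)) : Prop :=
  ∃ (Y' Z' : FGModuleCat.{v} A) (i : X.as ⟶ Y') (p : Y' ⟶ Z')
    (t : Y' ⟶ inj k X.as) (d : Z' ⟶ cosyzygy k X.as)
    (eY : (toStMod A).obj Y' ≅ Y) (eZ : (toStMod A).obj Z' ≅ Z),
    IsShortExact i p ∧ i ≫ t = injMap k X.as ∧ p ≫ d = t ≫ cosyzygyMap k X.as ∧
    (toStMod A).map i ≫ eY.hom = f ∧ (toStMod A).map p ≫ eZ.hom = eY.hom ≫ g ∧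
    (toStMod A).map d = eZ.hom ≫ h

/-- A (full, replete) subcategory of the stable category is thick when it is closed under direct
summands and when, for every exact triangle with two of its objects in the subcategory, the third
one lies in it as well. -/
structure IsThick (P : ObjectProperty (StMod A)) : Prop where
  retract : P.IsStableUnderRetracts
  triangle₁ : ∀ {X Y Z : StMod A} (f : X ⟶ Y) (g : Y ⟶ Z)
    (h : Z ⟶ (toStMod A).obj (cosyzygy k X.as)), IsExactTriangle k f g h → P Y → P Z → P X
  triangle₂ : ∀ {X Y Z : StMod A} (f : X ⟶ Y) (g : Y ⟶ Z)
    (h : Z ⟶ (toStMod A).obj (cosyzygy k X.as)), IsExactTriangle k f g h → P X → P Z → P Y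
  triangle₃ : ∀ {X Y Z : StMod A} (f : X ⟶ Y) (g : Y ⟶ Z)
    (h : Z ⟶ (toStMod A).obj (cosyzygy k X.as)), IsExactTriangle k f g h → P X → P Y → P Z

/-- `thick(L)`: the smallest thick subcategory of the stable category that contains `L`. -/
def thick (L : FGModuleCat.{v} A) : ObjectProperty (StMod A) := fun X =>
  ∀ P : ObjectProperty (StMod A), IsThick k P → P ((toStMod A).obj L) → P X

/-- The functor `M ↦ (stable Hom(Ω^n L, M))_n`, restricted to `thick(L)`, with values in
graded abelian groups. -/
def stableHom (L : FGModuleCat.{v} A) : (thick k L).FullSubcategory ⥤ (ℤ → AddCommGrpCat.{v}) :=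
  (thick k L).ι ⋙ Functor.pi' fun n : ℤ =>
    preadditiveCoyoneda.obj (Opposite.op ((toStMod A).obj (omega k n L)))

/-- The direct sum of the modules `Ω^(n j) L`, for `j` in a finite index set. -/
def sumOmega (L : FGModuleCat.{v} A) {m : ℕ} (n : Fin m → ℤ) : FGModuleCat.{v} A :=
  FGModuleCat.of A (∀ j : Fin m, omega k (n j) L)

end Syzygy

end StableModule

end

/-! The substance is that faithfulness forces every indecomposable non-projective `X` in the thick
subcategory to be a suspension of `L`. For such `X` there is a map `e : X → ΩX` that is not stably
zero but becomes so after precomposition with any map `N → X` that is not a split epimorphism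
(`IsSymmetrizing.exists_syzygy_map`). Faithfulness gives some `Ωⁿ L → X` not killed by `e`, so `X`
is a retract of `Ωⁿ L`. Stable idempotents of `Ωⁿ L` are trivial, by Fitting's lemma for `L` and
transfer along syzygies, so the retract is everything. Decomposition into indecomposables gives the
general case.

The map `e` comes from a trace form. Since `Hom_A(Y, A) ≅ Hom_k(Y, k)` through `t`, a functional on
`End X` is a trace `f ↦ tr (g f π)` with `π : Aⁿ → X` a free cover and `g : X → Aⁿ`. Taking the
functional to be `1` at the identity and `0` on nonunits forces `π g = 0`, and `g` corestricts to
`e`.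

Conversely, a morphism out of a finite sum of suspensions is determined by its restrictions to the
summands (`eq_of_isSumOmega`). -/

noncomputable section

namespace StableModule

/-! ### Symmetrizing forms and self-injectivity. -/

section Algebra

variable {k : Type u} {A : Type v} [Field k] [Ring A] [Algebra k A]

/-- A linear form `t` such that `(a, b) ↦ t (a * b)` is a nondegenerate symmetric bilinear form. -/
structure IsSymmetrizing (t : A →ₗ[k] k) : Prop where
  symm : ∀ a b : A, t (a * b) = t (b * a)
  nondeg : ∀ a : A, (∀ b : A, t (a * b) = 0) → a = 0

namespace IsSymmetrizing

variable {t : A →ₗ[k] k}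

/-- Maps into `A` can be tested after applying `t`, because `g (b • y) = b * g y` and `t` is
nondegenerate. -/
lemma map_eq_zero (ht : IsSymmetrizing t) {Y : Type*} [AddCommGroup Y] [Module A Y]
    (g : Y →ₗ[A] A) (y : Y) (h : ∀ b : A, t (g (b • y)) = 0) : g y = 0 :=
  ht.nondeg _ fun b => by rw [ht.symm, ← smul_eq_mul, ← map_smul, h]

/-- Every `k`-linear functional on `Y` is `t ∘ g` for an `A`-linear map `g : Y → A`. -/
lemma exists_lift [Module.Finite k A] (ht : IsSymmetrizing t) {Y : Type*} [AddCommGroup Y]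
    [Module A Y] [Module k Y] [IsScalarTower k A Y] (l : Y →ₗ[k] k) :
    ∃ g : Y →ₗ[A] A, ∀ y, t (g y) = l y := by
  let β : A →ₗ[k] Module.Dual k A :=
    LinearMap.mk₂ k (fun a b => t (b * a)) (fun a b c => by simp [mul_add])
      (fun c a b => by simp) (fun a b c => by simp [add_mul]) (fun c a b => by simp)
  have hβ : ∀ a b, β a b = t (b * a) := fun _ _ => rfl
  have hinj : Function.Injective β := (injective_iff_map_eq_zero β).mpr fun a ha =>
    ht.nondeg a fun b => by rw [ht.symm, ← hβ, ha]; rfl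
  have hsurj : Function.Surjective β :=
    (LinearMap.injective_iff_surjective_of_finrank_eq_finrank
      Subspace.dual_finrank_eq.symm).mp hinj
  -- `g y` is the element of `A` representing `b ↦ l (b • y)`; uniqueness of representing elements
  -- makes `g` linear.
  let m (y : Y) : Module.Dual k A := l ∘ₗ (LinearMap.toSpanSingleton A Y y).restrictScalars k
  choose g hg using fun y => hsurj (m y)
  have key : ∀ y b, t (b * g y) = l (b • y) := fun y b => by rw [← hβ, hg]; rfl
  refine ⟨⟨⟨g, fun x y => hinj (LinearMap.ext fun b => ?_)⟩,
    fun a y => hinj (LinearMap.ext fun b => ?_)⟩, fun y => ?_⟩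
  · rw [hβ, hβ, key, mul_add, map_add, key, key, smul_add, map_add]
  · rw [hβ, hβ, key, RingHom.id_apply, smul_eq_mul, ← mul_assoc, key, mul_smul]
  · simpa using key y 1

lemma exists_pi_lift [Module.Finite k A] (ht : IsSymmetrizing t) {ι : Type*} [Fintype ι]
    [DecidableEq ι] {Y : Type*} [AddCommGroup Y]
    [Module A Y] [Module k Y] [IsScalarTower k A Y] (l : (ι → Y) →ₗ[k] k) :
    ∃ g : Y →ₗ[A] (ι → A), ∀ y : ι → Y, ∑ i, t (g (y i) i) = l y := by
  choose g hg using fun i => ht.exists_lift (l ∘ₗ LinearMap.single k (fun _ : ι => Y) i)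
  refine ⟨LinearMap.pi g, fun y => ?_⟩
  conv_rhs => rw [← Finset.univ_sum_single y, map_sum]
  exact Finset.sum_congr rfl fun i _ => hg i (y i)

/-- Finitely generated free modules over a symmetric algebra are injective. -/
lemma exists_extension_pi [Module.Finite k A] (ht : IsSymmetrizing t) {ι : Type*}
    {X Y : Type*} [AddCommGroup X] [Module A X] [AddCommGroup Y] [Module A Y]
    (i : X →ₗ[A] Y) (hi : Function.Injective i) (f : X →ₗ[A] (ι → A)) :
    ∃ g : Y →ₗ[A] (ι → A), g ∘ₗ i = f := by
  letI : Module k X := Module.restrictScalars k A X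
  letI : Module k Y := Module.restrictScalars k A Y
  haveI : IsScalarTower k A X := IsScalarTower.restrictScalars k A X
  haveI : IsScalarTower k A Y := IsScalarTower.restrictScalars k A Y
  obtain ⟨r, hr⟩ := (i.restrictScalars k).exists_leftInverse_of_injective
    (LinearMap.ker_eq_bot.mpr hi)
  -- Each coordinate of `f` becomes a functional, is extended along the `k`-linear retraction `r`,
  -- and is lifted back to an `A`-linear map.
  choose g hg using fun j => ht.exists_lift
    (t ∘ₗ ((LinearMap.proj j ∘ₗ f : X →ₗ[A] A).restrictScalars k) ∘ₗ r)
  refine ⟨LinearMap.pi g, LinearMap.ext fun x => funext fun j => ?_⟩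
  rw [← sub_eq_zero]
  refine ht.map_eq_zero (g j ∘ₗ i - LinearMap.proj j ∘ₗ f) x fun b => ?_
  have : r (i (b • x)) = b • x := LinearMap.congr_fun hr _
  rw [LinearMap.sub_apply, map_sub, LinearMap.comp_apply, hg]
  simp only [LinearMap.comp_apply, LinearMap.restrictScalars_apply, this, sub_self]

/-- Every finitely generated module over a symmetric algebra embeds into a free module. -/
lemma exists_embedding [Module.Finite k A] (ht : IsSymmetrizing t) (Y : Type*)
    [AddCommGroup Y] [Module A Y] [Module.Finite A Y] :
    ∃ (n : ℕ) (g : Y →ₗ[A] (Fin n → A)), Function.Injective g := by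
  letI : Module k Y := Module.restrictScalars k A Y
  haveI : IsScalarTower k A Y := IsScalarTower.restrictScalars k A Y
  haveI : Module.Finite k Y := Module.Finite.trans A Y
  let b := Module.finBasis k Y
  choose g hg using fun j => ht.exists_lift (b.coord j)
  refine ⟨_, LinearMap.pi g, (injective_iff_map_eq_zero _).mpr fun y hy => ?_⟩
  refine b.ext_elem fun j => ?_
  have : g j y = 0 := congrFun hy j
  have h2 := hg j y
  rw [this, map_zero] at h2
  simpa using h2.symm

/-- A map into a projective module extends along injections. -/
lemma exists_extension [Module.Finite k A] (ht : IsSymmetrizing t)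
    {X Y P : Type*} [AddCommGroup X] [Module A X] [AddCommGroup Y] [Module A Y]
    [AddCommGroup P] [Module A P] [Module.Projective A P] [Module.Finite A P]
    (i : X →ₗ[A] Y) (hi : Function.Injective i) (f : X →ₗ[A] P) :
    ∃ g : Y →ₗ[A] P, g ∘ₗ i = f := by
  obtain ⟨n, p, hp⟩ := Module.Finite.exists_fin' A P
  obtain ⟨s, hs⟩ := Module.projective_lifting_property p LinearMap.id hp
  obtain ⟨g, hg⟩ := ht.exists_extension_pi i hi (s ∘ₗ f)
  exact ⟨p ∘ₗ g, by rw [LinearMap.comp_assoc, hg, ← LinearMap.comp_assoc, hs, LinearMap.id_comp]⟩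

lemma projective_of_injective [Module.Finite k A] (ht : IsSymmetrizing t)
    (Y : Type v) [AddCommGroup Y] [Module A Y] [Module.Finite A Y] [hY : Module.Injective A Y] :
    Module.Projective A Y := by
  obtain ⟨n, g, hg⟩ := ht.exists_embedding Y
  obtain ⟨h, hh⟩ := hY.out g hg LinearMap.id
  exact Module.Projective.of_split g h (LinearMap.ext hh)

end IsSymmetrizing

end Algebra

/-! ### Indecomposable modules and local endomorphism rings. -/

section Local

variable {A : Type*} [Ring A]

/-- A module is indecomposable: it is not an internal direct sum of two nonzero submodules. -/
def IsIndecomposable (A M : Type*) [Ring A] [AddCommGroup M] [Module A M] : Prop :=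
  ∀ p q : Submodule A M, IsCompl p q → p = ⊥ ∨ q = ⊥

variable {M : Type*} [AddCommGroup M] [Module A M]

/-- Fitting's lemma. -/
lemma IsIndecomposable.isNilpotent_or_isUnit [IsNoetherian A M] [IsArtinian A M]
    (h : IsIndecomposable A M) (f : Module.End A M) : IsNilpotent f ∨ IsUnit f := by
  obtain ⟨n, hn⟩ := Filter.eventually_atTop.mp f.eventually_isCompl_ker_pow_range_pow
  have hc := hn (n + 1) n.le_succ
  rcases h _ _ hc with h1 | h1
  · right
    have htop : LinearMap.range (f ^ (n + 1)) = ⊤ := by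
      have := hc.sup_eq_top; rwa [h1, bot_sup_eq] at this
    have : IsUnit (f ^ (n + 1)) := (Module.End.isUnit_iff _).mpr
      ⟨LinearMap.ker_eq_bot.mp h1, LinearMap.range_eq_top.mp htop⟩
    exact (isUnit_pow_iff n.succ_ne_zero).mp this
  · exact Or.inl ⟨n + 1, LinearMap.range_eq_bot.mp h1⟩

lemma IsIndecomposable.isLocalRing [IsNoetherian A M] [IsArtinian A M] [Nontrivial M]
    (h : IsIndecomposable A M) : IsLocalRing (Module.End A M) :=
  IsLocalRing.of_isUnit_or_isUnit_one_sub_self fun f =>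
    (h.isNilpotent_or_isUnit f).symm.imp_right fun hf => hf.isUnit_one_sub

end Local

/-! ### Nonunits in the endomorphism ring. -/

section Ghost

variable {k : Type u} {A : Type v} [Field k] [Ring A] [Algebra k A]

/-- Used contrapositively: endomorphisms of a non-projective module that factor through a projective
are nonunits. -/
lemma projective_of_isUnit_comp {M P : Type*} [AddCommGroup M] [Module A M] [AddCommGroup P]
    [Module A P] [Module.Projective A P] (a : M →ₗ[A] P) (b : P →ₗ[A] M)
    (h : IsUnit (b ∘ₗ a : Module.End A M)) : Module.Projective A M := by
  obtain ⟨c, hc⟩ := h.exists_left_inv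
  exact Module.Projective.of_split a (c ∘ₗ b) hc

/-- A functional on `End M` that vanishes on nonunits but not at the identity. -/
lemma exists_functional {M : Type*} [AddCommGroup M] [Module A M] [Module k M] [IsScalarTower k A M]
    [IsLocalRing (Module.End A M)] :
    ∃ φ : Module.End A M →ₗ[k] k, φ 1 = 1 ∧ ∀ f, ¬ IsUnit f → φ f = 0 := by
  let N : Submodule k (Module.End A M) :=
    { carrier := {f | ¬ IsUnit f}
      add_mem' := fun {f g} hf hg h => by
        rcases IsLocalRing.isUnit_or_isUnit_of_isUnit_add h with h | h
        exacts [hf h, hg h]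
      zero_mem' := not_isUnit_zero
      smul_mem' := fun c f hf h => by
        rcases eq_or_ne c 0 with rfl | hc
        · simp at h
        · exact hf ((isUnit_smul_iff (Units.mk0 c hc) f).mp h) }
  have h1 : (1 : Module.End A M) ∉ N := fun h => h isUnit_one
  obtain ⟨φ, hφ, hN⟩ := Submodule.exists_le_ker_of_notMem h1
  refine ⟨(φ 1)⁻¹ • φ, by simp [hφ], fun f hf => ?_⟩
  have : φ f = 0 := hN hf
  simp [this]

end Ghost

/-! ### The trace form and the almost vanishing map. -/

section Duality

variable {k : Type u} {A : Type v} [Field k] [Ring A] [Algebra k A]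

/-- Dualization over a field is exact, so the range of the transpose is the annihilator of the
kernel. -/
lemma exists_dual_factorization {V W : Type*} [AddCommGroup V] [Module k V] [AddCommGroup W]
    [Module k W] (D : V →ₗ[k] W) (l : V →ₗ[k] k) (h : ∀ v, D v = 0 → l v = 0) :
    ∃ l' : W →ₗ[k] k, ∀ v, l' (D v) = l v := by
  have : l ∈ LinearMap.range D.dualMap := by
    rw [LinearMap.range_dualMap_eq_dualAnnihilator_ker, Submodule.mem_dualAnnihilator]
    exact h
  obtain ⟨l', rfl⟩ := this
  exact ⟨l', fun _ => rfl⟩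

lemma exists_comp_eq_of_surjective {X Y Z : Type*} [AddCommGroup X] [Module A X] [AddCommGroup Y]
    [Module A Y] [AddCommGroup Z] [Module A Z] (p : X →ₗ[A] Y) (hp : Function.Surjective p)
    (u : X →ₗ[A] Z) (h : ∀ x, p x = 0 → u x = 0) : ∃ d : Y →ₗ[A] Z, d ∘ₗ p = u := by
  refine ⟨(LinearMap.ker p).liftQ u h ∘ₗ (p.quotKerEquivOfSurjective hp).symm.toLinearMap,
    LinearMap.ext fun x => ?_⟩
  have : (p.quotKerEquivOfSurjective hp).symm (p x) = (LinearMap.ker p).mkQ x := by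
    rw [LinearEquiv.symm_apply_eq]; rfl
  simp only [LinearMap.comp_apply, LinearEquiv.coe_coe, this]
  exact (LinearMap.ker p).liftQ_apply u x

lemma map_pi_eq_sum {m : ℕ} {Y : Type*} [AddCommGroup Y] [Module A Y]
    (f : (Fin m → A) →ₗ[A] Y) (x : Fin m → A) : f x = ∑ j, x j • f (Pi.single j 1) := by
  conv_lhs => rw [pi_eq_sum_univ' x, map_sum]
  refine Finset.sum_congr rfl fun j _ => ?_
  rw [map_smul]

namespace IsSymmetrizing

variable {t : A →ₗ[k] k}

/-- The trace form on maps between free modules is symmetric. -/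
lemma trace_comm (ht : IsSymmetrizing t) {m n : ℕ} (a : (Fin n → A) →ₗ[A] (Fin m → A))
    (b : (Fin m → A) →ₗ[A] (Fin n → A)) :
    ∑ i, t (b (a (Pi.single i 1)) i) = ∑ j, t (a (b (Pi.single j 1)) j) := by
  simp only [map_pi_eq_sum b (a _), map_pi_eq_sum a (b _), Finset.sum_apply, Pi.smul_apply,
    smul_eq_mul, map_sum]
  rw [Finset.sum_comm]
  exact Finset.sum_congr rfl fun j _ => Finset.sum_congr rfl fun i _ => ht.symm _ _

variable [Module.Finite k A]

/-- Functionals over `k` separate points, and each has the form `t ∘ a`. -/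
lemma eq_zero_of_forall (ht : IsSymmetrizing t) {Y : Type*} [AddCommGroup Y]
    [Module A Y] (y : Y) (h : ∀ a : Y →ₗ[A] A, t (a y) = 0) : y = 0 := by
  letI : Module k Y := Module.restrictScalars k A Y
  haveI : IsScalarTower k A Y := IsScalarTower.restrictScalars k A Y
  by_contra hy
  obtain ⟨l, hl⟩ := Module.Projective.exists_dual_ne_zero k hy
  obtain ⟨g, hg⟩ := ht.exists_lift l
  exact hl (by rw [← hg, h])

/-- If a map `g : N → Aⁿ` is orthogonal, under the trace form, to all maps `Aⁿ → N` that factor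
through the quotient `π : Aⁿ → M`, then it factors through a free cover of `ker π`. -/
lemma exists_factorization_of_orthogonal (ht : IsSymmetrizing t) {M N : Type*} [AddCommGroup M]
    [Module A M] [AddCommGroup N] [Module A N] {n : ℕ} (π : (Fin n → A) →ₗ[A] M)
    (hπ : Function.Surjective π) (g : N →ₗ[A] (Fin n → A))
    (h : ∀ f : M →ₗ[A] N, ∑ i, t (g (f (π (Pi.single i 1))) i) = 0) :
    ∃ (m : ℕ) (w : N →ₗ[A] (Fin m → A)) (d : (Fin m → A) →ₗ[A] (Fin n → A)),
      π ∘ₗ d = 0 ∧ g = d ∘ₗ w := by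
  letI : Module k N := Module.restrictScalars k A N
  haveI : IsScalarTower k A N := IsScalarTower.restrictScalars k A N
  haveI : IsNoetherianRing A := isNoetherian_of_tower k inferInstance
  obtain ⟨m, d₀, hd₀⟩ := Module.Finite.exists_fin' A (LinearMap.ker π)
  let d : (Fin m → A) →ₗ[A] (Fin n → A) := (LinearMap.ker π).subtype ∘ₗ d₀
  have hπd : π ∘ₗ d = 0 := LinearMap.ext fun x => (d₀ x).2
  have hker : ∀ x, π x = 0 → ∃ z, d z = x := fun x hx => by
    obtain ⟨z, hz⟩ := hd₀ ⟨x, hx⟩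
    exact ⟨z, congrArg Subtype.val hz⟩
  -- With `Hom(Aⁿ, N)` identified with `Nⁿ`, `D` is precomposition with `d`. Its kernel is `Hom(M,
  -- N)`, where `l`, the trace pairing with `g`, vanishes by hypothesis; so `l` factors through `D`.
  let D : (Fin n → N) →ₗ[k] (Fin m → N) :=
    { toFun := fun y j => ∑ i, d (Pi.single j 1) i • y i
      map_add' := fun y z => by ext j; simp [Finset.sum_add_distrib]
      map_smul' := fun c y => by
        ext j; simp only [Pi.smul_apply, RingHom.id_apply, Finset.smul_sum]
        exact Finset.sum_congr rfl fun i _ => smul_comm _ _ _ }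
  let l : (Fin n → N) →ₗ[k] k :=
    ∑ i, t ∘ₗ ((LinearMap.proj i ∘ₗ g : N →ₗ[A] A).restrictScalars k) ∘ₗ LinearMap.proj i
  have hl : ∀ y, l y = ∑ i, t (g (y i) i) := fun y => by simp [l]
  obtain ⟨l', hl'⟩ := exists_dual_factorization D l fun y hy => by
    let u : (Fin n → A) →ₗ[A] N := Fintype.linearCombination A y
    have hu : ∀ i, u (Pi.single i 1) = y i := fun i => by simp [u]
    have hud : ∀ z, u (d z) = 0 := fun z => by
      rw [map_pi_eq_sum d z, map_sum]
      refine Finset.sum_eq_zero fun j _ => ?_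
      rw [map_smul]
      have : u (d (Pi.single j 1)) = D y j := by
        simp [u, D, Fintype.linearCombination_apply]
      rw [this, hy, Pi.zero_apply, smul_zero]
    obtain ⟨f, hf⟩ := exists_comp_eq_of_surjective π hπ u fun x hx => by
      obtain ⟨z, rfl⟩ := hker x hx
      exact hud z
    rw [hl, ← h f]
    exact Finset.sum_congr rfl fun i _ => by rw [← hu, ← hf]; rfl
  obtain ⟨w, hw⟩ := ht.exists_pi_lift l'
  refine ⟨m, w, d, hπd, LinearMap.ext fun y => funext fun i => ?_⟩
  rw [← sub_eq_zero]
  refine ht.map_eq_zero (LinearMap.proj i ∘ₗ (g - d ∘ₗ w)) y fun b => ?_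
  -- A family concentrated at index `i` isolates the `i`th coordinates of `g` and `d ∘ₗ w`.
  have e1 := hl' (Pi.single i (b • y))
  rw [hl, ← hw] at e1
  have e2 : ∀ j, D (Pi.single i (b • y)) j = d (Pi.single j 1) i • b • y := fun j => by
    change ∑ i', d (Pi.single j 1) i' • (Pi.single i (b • y) : Fin n → N) i' = _
    rw [Finset.sum_eq_single i (fun i' _ hi' => by simp [hi']) (by simp)]
    simp
  have e0 : ∑ i', t (g ((Pi.single i (b • y) : Fin n → N) i') i') = t (g (b • y) i) := by
    rw [Finset.sum_eq_single i (fun i' _ hi' => by simp [hi']) (by simp), Pi.single_eq_same]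
  rw [e0] at e1
  simp only [e2, map_smul, Pi.smul_apply, smul_eq_mul] at e1
  have e3 : t (d (w (b • y)) i) = t (g (b • y) i) := by
    rw [map_smul g, Pi.smul_apply, smul_eq_mul, ← e1, map_pi_eq_sum d, Finset.sum_apply, map_sum]
    refine Finset.sum_congr rfl fun j _ => ?_
    rw [map_smul, Pi.smul_apply, Pi.smul_apply, smul_eq_mul, smul_eq_mul, ht.symm]
  change t (g (b • y) i - d (w (b • y)) i) = 0
  rw [map_sub, e3, sub_self]

/-- The map `v : M → Ω M = ker π`, here viewed as a map `g : M → Aⁿ`, in an almost split triangle: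
it is not stably zero but it annihilates every map `N → M` that is not a split epimorphism. -/
lemma exists_almost_vanishing (ht : IsSymmetrizing t) {M : Type v} [AddCommGroup M]
    [Module A M] [Module.Finite A M] (hM : IsIndecomposable A M) (hp : ¬ Module.Projective A M) :
    ∃ (n : ℕ) (π : (Fin n → A) →ₗ[A] M) (g : M →ₗ[A] (Fin n → A)),
      Function.Surjective π ∧ π ∘ₗ g = 0 ∧
      (∀ (q : ℕ) (a : M →ₗ[A] (Fin q → A)) (b : (Fin q → A) →ₗ[A] (Fin n → A)),
        π ∘ₗ b = 0 → g ≠ b ∘ₗ a) ∧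
      ∀ (N : Type v) [AddCommGroup N] [Module A N] (h : N →ₗ[A] M),
        (∀ f : M →ₗ[A] N, ¬ IsUnit (h ∘ₗ f : Module.End A M)) →
        ∃ (m : ℕ) (w : N →ₗ[A] (Fin m → A)) (d : (Fin m → A) →ₗ[A] (Fin n → A)),
          π ∘ₗ d = 0 ∧ g ∘ₗ h = d ∘ₗ w := by
  letI : Module k M := Module.restrictScalars k A M
  haveI : IsScalarTower k A M := IsScalarTower.restrictScalars k A M
  haveI : IsNoetherianRing A := isNoetherian_of_tower k inferInstance
  haveI : IsArtinianRing A := isArtinian_of_tower k inferInstance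
  haveI : Nontrivial M := by
    by_contra h
    rw [not_nontrivial_iff_subsingleton] at h
    exact hp inferInstance
  haveI := hM.isLocalRing
  obtain ⟨φ, hφ1, hφ⟩ := exists_functional (k := k) (A := A) (M := M)
  obtain ⟨n, π, hπ⟩ := Module.Finite.exists_fin' A M
  -- Evaluation at generators is injective on `End M`, so `φ` extends to a functional on `Mⁿ`.
  let E : Module.End A M →ₗ[k] (Fin n → M) :=
    { toFun := fun f i => f (π (Pi.single i 1))
      map_add' := fun _ _ => rfl
      map_smul' := fun _ _ => rfl }
  have hE : ∀ f, E f = 0 → φ f = 0 := fun f hf => by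
    have : f = 0 := LinearMap.ext fun x => by
      obtain ⟨z, rfl⟩ := hπ x
      rw [map_pi_eq_sum π z, map_sum]
      refine Finset.sum_eq_zero fun j _ => ?_
      rw [map_smul]
      have : f (π (Pi.single j 1)) = 0 := congrFun hf j
      rw [this, smul_zero]
    rw [this, map_zero]
  obtain ⟨l, hl⟩ := exists_dual_factorization E φ hE
  obtain ⟨g, hg⟩ := ht.exists_pi_lift l
  have hgφ : ∀ f : Module.End A M, ∑ i, t (g (f (π (Pi.single i 1))) i) = φ f := fun f => by
    rw [← hl, ← hg]; rfl
  refine ⟨n, π, g, hπ, LinearMap.ext fun y => ht.eq_zero_of_forall _ fun a => ?_,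
    fun q a b hb hgab => ?_, fun N _ _ h hh => ?_⟩
  -- `x ↦ a x • y` factors through `A`, hence is a nonunit; its trace against `g` is `t (a (π (g
  -- y)))`.
  · let f : Module.End A M := LinearMap.toSpanSingleton A M y ∘ₗ a
    have hf : φ f = 0 := hφ f fun hu => hp (projective_of_isUnit_comp _ _ hu)
    rw [LinearMap.comp_apply, map_pi_eq_sum π, map_sum, map_sum, ← hf, ← hgφ]
    refine Finset.sum_congr rfl fun i _ => ?_
    simp only [f, LinearMap.comp_apply, LinearMap.toSpanSingleton_apply, map_smul, Pi.smul_apply,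
      smul_eq_mul]
    exact ht.symm _ _
  -- If `g = b ∘ₗ a`, cyclicity turns `φ 1 = 1` into the trace of `a ∘ₗ π ∘ₗ b`, which is zero.
  · have h1 := hgφ 1
    rw [hφ1, hgab] at h1
    have h2 := ht.trace_comm (a ∘ₗ π) b
    have h3 : ∀ j, π (b j) = 0 := fun j => LinearMap.congr_fun hb j
    simp only [LinearMap.comp_apply, h3, map_zero, Pi.zero_apply, Finset.sum_const_zero] at h2
    exact one_ne_zero (h1.symm.trans h2)
  · refine ht.exists_factorization_of_orthogonal π hπ (g ∘ₗ h) fun f => ?_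
    rw [← hφ _ (hh f), ← hgφ]
    rfl

end IsSymmetrizing
end Duality

/-! ### Zero objects, retracts and idempotents in the stable category. -/

section Category

variable {A : Type v} [Ring A]

/-- The morphism of `FGModuleCat A` given by a linear map. -/
abbrev homMk {X Y : FGModuleCat.{v} A} (f : X →ₗ[A] Y) : X ⟶ Y := FGModuleCat.ofHom f

/-- The isomorphism of `FGModuleCat A` given by a linear equivalence. -/
def isoMk {X Y : FGModuleCat.{v} A} (e : X ≃ₗ[A] Y) : X ≅ Y := e.toFGModuleCatIso

instance : (toStMod A).Additive := Quotient.functor_additive _ (stableRel_add A)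

lemma toStMod_map_eq_zero_iff {X Y : FGModuleCat.{v} A} (f : X ⟶ Y) :
    (toStMod A).map f = 0 ↔
      ∃ (P : FGModuleCat.{v} A) (a : X ⟶ P) (b : P ⟶ Y), Module.Projective A P ∧ f = a ≫ b := by
  rw [← (toStMod A).map_zero, Quotient.functor_map_eq_iff]
  simp [stableRel]

/-- A finitely generated projective is a retract of a free module, on which the trace form has
coordinates. -/
lemma exists_free_factorization {X Y : FGModuleCat.{v} A} {f : X ⟶ Y}
    (h : (toStMod A).map f = 0) :
    ∃ (q : ℕ) (a : X →ₗ[A] (Fin q → A)) (b : (Fin q → A) →ₗ[A] Y), f.hom.hom = b ∘ₗ a := by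
  obtain ⟨P, a, b, hP, rfl⟩ := (toStMod_map_eq_zero_iff f).mp h
  obtain ⟨n, p, hp⟩ := Module.Finite.exists_fin' A P
  obtain ⟨s, hs⟩ := Module.projective_lifting_property p LinearMap.id hp
  refine ⟨n, s ∘ₗ a.hom.hom, b.hom.hom ∘ₗ p, ?_⟩
  rw [LinearMap.comp_assoc, ← LinearMap.comp_assoc _ _ p, hs, LinearMap.id_comp]
  rfl

lemma toStMod_map_eq_zero {X Y : FGModuleCat.{v} A} (f : X ⟶ Y) {q : ℕ}
    (a : X →ₗ[A] (Fin q → A)) (b : (Fin q → A) →ₗ[A] Y) (h : f.hom.hom = b ∘ₗ a) :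
    (toStMod A).map f = 0 :=
  (toStMod_map_eq_zero_iff f).mpr ⟨FGModuleCat.of A (Fin q → A), homMk a, homMk b,
    (inferInstance : Module.Projective A (Fin q → A)), FGModuleCat.hom_ext h⟩

lemma isZero_toStMod_iff (X : FGModuleCat.{v} A) :
    Limits.IsZero ((toStMod A).obj X) ↔ Module.Projective A X := by
  rw [Limits.IsZero.iff_id_eq_zero, ← (toStMod A).map_id, toStMod_map_eq_zero_iff]
  constructor
  · rintro ⟨P, a, b, hP, h⟩
    exact Module.Projective.of_split a.hom.hom b.hom.hom (by
      rw [← FGModuleCat.hom_hom_comp, ← h]; rfl)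
  · exact fun h => ⟨X, 𝟙 X, 𝟙 X, h, by simp⟩

/-- An object all of whose idempotent endomorphisms are trivial. -/
def HasTrivialIdempotents {C : Type*} [Category* C] [Preadditive C] (X : C) : Prop :=
  ∀ e : X ⟶ X, e ≫ e = e → e = 0 ∨ e = 𝟙 X

/-- The idempotent cut out by the retract is zero only if `X` is zero; otherwise it is the identity,
and the retraction is invertible. -/
lemma HasTrivialIdempotents.iso_of_retract {C : Type*} [Category* C] [Preadditive C] {X Y : C}
    (hY : HasTrivialIdempotents Y) (r : Retract X Y) (hX : ¬ Limits.IsZero X) :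
    Nonempty (X ≅ Y) := by
  rcases hY (r.r ≫ r.i) (by simp) with h | h
  · refine absurd ((Limits.IsZero.iff_id_eq_zero X).mpr ?_) hX
    calc 𝟙 X = r.i ≫ (r.r ≫ r.i) ≫ r.r := by simp
      _ = 0 := by simp [h]
  · exact ⟨⟨r.i, r.r, r.retract, h⟩⟩

/-- A representative `f` of a stable idempotent need not be idempotent, but its positive powers are
all stably equal to `f`. By Fitting's lemma `f` is nilpotent, hence stably zero, or invertible,
hence stably the identity. -/
lemma hasTrivialIdempotents_of_isIndecomposable {X : FGModuleCat.{v} A} [IsNoetherian A X]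
    [IsArtinian A X] (h : IsIndecomposable A X) :
    HasTrivialIdempotents ((toStMod A).obj X) := by
  intro e he
  obtain ⟨f, rfl⟩ := (toStMod A).map_surjective e
  have hpow : ∀ n : ℕ, (toStMod A).map (homMk (f.hom.hom ^ (n + 1))) = (toStMod A).map f := by
    intro n
    induction n with
    | zero => simp only [zero_add, pow_one]; rfl
    | succ n ih =>
      have : homMk (f.hom.hom ^ (n + 1 + 1)) = f ≫ homMk (f.hom.hom ^ (n + 1)) := by
        ext x; rw [pow_succ]; rfl
      rw [this, Functor.map_comp, ih, he]
  rcases h.isNilpotent_or_isUnit f.hom.hom with ⟨n, hn⟩ | hu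
  · left
    rw [← hpow n, pow_succ, hn, zero_mul]
    exact (toStMod A).map_zero _ _
  · right
    obtain ⟨g, hg⟩ := hu.exists_left_inv
    have : f ≫ homMk g = 𝟙 X := FGModuleCat.hom_ext hg
    have h2 := (toStMod A).congr_map this
    rw [Functor.map_comp, (toStMod A).map_id] at h2
    calc (toStMod A).map f = (toStMod A).map f ≫ (toStMod A).map f ≫ (toStMod A).map (homMk g) := by
          rw [h2, Category.comp_id]
      _ = 𝟙 _ := by rw [← Category.assoc, he, h2]

lemma isIndecomposable_of_indecomposable {M : ModuleCat.{v} A} (h : Indecomposable M) :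
    IsIndecomposable A M := by
  intro p q hpq
  have e : M ≅ ModuleCat.of A p ⊞ ModuleCat.of A q :=
    (Submodule.prodEquivOfIsCompl p q hpq).symm.toModuleIso ≪≫
      (ModuleCat.biprodIsoProd (ModuleCat.of A p) (ModuleCat.of A q)).symm
  refine (h.2 _ _ e).imp (fun h => ?_) (fun h => ?_) <;>
  · have := ModuleCat.subsingleton_of_isZero h
    exact Submodule.subsingleton_iff_eq_bot.mp this

end Category

/-! ### Transfer of stable endomorphisms along syzygies. -/

section Transfer

variable {k : Type u} {A : Type v} [Field k] [Ring A] [Algebra k A] [Module.Finite k A]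
variable {t : A →ₗ[k] k}

/-- Endomorphisms of the ends of a short exact sequence that extend to an endomorphism of the
sequence. -/
def EndRel {X P Z : FGModuleCat.{v} A} (i : Z ⟶ P) (p : P ⟶ X) (f : X ⟶ X) (g : Z ⟶ Z) : Prop :=
  ∃ w : P ⟶ P, i ≫ w = g ≫ i ∧ p ≫ f = w ≫ p

lemma EndRel.comp {X P Z : FGModuleCat.{v} A} {i : Z ⟶ P} {p : P ⟶ X} {f f' : X ⟶ X} {g g' : Z ⟶ Z}
    (h : EndRel i p f g) (h' : EndRel i p f' g') : EndRel i p (f ≫ f') (g ≫ g') := by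
  obtain ⟨w, h1, h2⟩ := h
  obtain ⟨w', h1', h2'⟩ := h'
  exact ⟨w ≫ w', by rw [reassoc_of% h1, h1', Category.assoc],
    by rw [reassoc_of% h2, h2', Category.assoc]⟩

lemma EndRel.sub {X P Z : FGModuleCat.{v} A} {i : Z ⟶ P} {p : P ⟶ X} {f f' : X ⟶ X} {g g' : Z ⟶ Z}
    (h : EndRel i p f g) (h' : EndRel i p f' g') : EndRel i p (f - f') (g - g') := by
  obtain ⟨w, h1, h2⟩ := h
  obtain ⟨w', h1', h2'⟩ := h'
  exact ⟨w - w', by simp [h1, h1', Preadditive.comp_sub, Preadditive.sub_comp],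
    by simp [h2, h2', Preadditive.comp_sub, Preadditive.sub_comp]⟩

lemma EndRel.id {X P Z : FGModuleCat.{v} A} (i : Z ⟶ P) (p : P ⟶ X) :
    EndRel i p (𝟙 X) (𝟙 Z) := ⟨𝟙 P, by simp, by simp⟩

lemma IsShortExact.exists_desc {X P Z W : FGModuleCat.{v} A} {i : Z ⟶ P} {p : P ⟶ X}
    (h : IsShortExact i p) (f : P ⟶ W) (hf : i ≫ f = 0) : ∃ d : X ⟶ W, p ≫ d = f := by
  obtain ⟨d, hd⟩ := exists_comp_eq_of_surjective p.hom.hom h.2.2 f.hom.hom fun x hx => by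
    obtain ⟨z, rfl⟩ := (h.2.1 x).mp hx
    exact LinearMap.congr_fun (congrArg (fun q => q.hom.hom) hf) z
  exact ⟨homMk d, FGModuleCat.hom_ext hd⟩

lemma IsShortExact.comp_eq_zero {X P Z : FGModuleCat.{v} A} {i : Z ⟶ P} {p : P ⟶ X}
    (h : IsShortExact i p) : i ≫ p = 0 :=
  FGModuleCat.hom_ext (LinearMap.ext fun x => h.2.1.apply_apply_eq_zero x)

lemma IsShortExact.mono {X P Z : FGModuleCat.{v} A} {i : Z ⟶ P} {p : P ⟶ X}
    (h : IsShortExact i p) : Mono i :=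
  ⟨fun _ _ e => FGModuleCat.hom_ext (LinearMap.ext fun x =>
    h.1 (LinearMap.congr_fun (congrArg (fun q => q.hom.hom) e) x))⟩

lemma IsShortExact.epi {X P Z : FGModuleCat.{v} A} {i : Z ⟶ P} {p : P ⟶ X}
    (h : IsShortExact i p) : Epi p :=
  ⟨fun _ _ e => FGModuleCat.hom_ext (LinearMap.ext fun x => by
    obtain ⟨y, rfl⟩ := h.2.2 x
    exact LinearMap.congr_fun (congrArg (fun q => q.hom.hom) e) y)⟩

lemma IsShortExact.exists_lift {X P Z W : FGModuleCat.{v} A} {i : Z ⟶ P} {p : P ⟶ X}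
    (h : IsShortExact i p) (f : W ⟶ P) (hf : f ≫ p = 0) : ∃ d : W ⟶ Z, d ≫ i = f := by
  have hr : ∀ x, f.hom.hom x ∈ LinearMap.range i.hom.hom := fun x =>
    (h.2.1 _).mp (LinearMap.congr_fun (congrArg (fun q => q.hom.hom) hf) x)
  refine ⟨homMk ((LinearEquiv.ofInjective i.hom.hom h.1).symm.toLinearMap ∘ₗ
    f.hom.hom.codRestrict _ hr), FGModuleCat.hom_ext (LinearMap.ext fun x => ?_)⟩
  exact congrArg Subtype.val ((LinearEquiv.ofInjective i.hom.hom h.1).apply_symm_apply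
    (f.hom.hom.codRestrict _ hr x))

lemma exists_lift_of_projective {X P Q : FGModuleCat.{v} A} (p : P ⟶ X)
    (hp : Function.Surjective p.hom.hom) [Module.Projective A Q] (f : Q ⟶ X) :
    ∃ g : Q ⟶ P, g ≫ p = f := by
  obtain ⟨g, hg⟩ := Module.projective_lifting_property p.hom.hom f.hom.hom hp
  exact ⟨homMk g, FGModuleCat.hom_ext hg⟩

lemma IsSymmetrizing.exists_hom_extension (ht : IsSymmetrizing t) {Z P Q : FGModuleCat.{v} A}
    (i : Z ⟶ P) (hi : Function.Injective i.hom.hom) [Module.Projective A Q] (f : Z ⟶ Q) :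
    ∃ g : P ⟶ Q, i ≫ g = f := by
  obtain ⟨g, hg⟩ := ht.exists_extension i.hom.hom hi f.hom.hom
  exact ⟨homMk g, FGModuleCat.hom_ext hg⟩

/-- If `f` factors through a projective `Q`, lift `Q → X` to `P`; subtracting the resulting map from
`w` gives a map into `Z`, through which `g` factors over `P`. The converse is dual, `Q` being
injective relative to `i`. -/
lemma IsShortExact.map_eq_zero_iff (ht : IsSymmetrizing t) {X P Z : FGModuleCat.{v} A} {i : Z ⟶ P}
    {p : P ⟶ X} (h : IsShortExact i p) [hP : Module.Projective A P] {f : X ⟶ X} {g : Z ⟶ Z}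
    (hfg : EndRel i p f g) : (toStMod A).map f = 0 ↔ (toStMod A).map g = 0 := by
  obtain ⟨w, h1, h2⟩ := hfg
  rw [toStMod_map_eq_zero_iff, toStMod_map_eq_zero_iff]
  constructor
  · rintro ⟨Q, a, b, hQ, rfl⟩
    obtain ⟨b', rfl⟩ := exists_lift_of_projective p h.2.2 b
    obtain ⟨c, hc⟩ := h.exists_lift (w - p ≫ a ≫ b') (by simp [← h2, Preadditive.sub_comp])
    refine ⟨P, i, c, hP, ?_⟩
    have : Mono i := h.mono
    rw [← cancel_mono i, Category.assoc, hc, Preadditive.comp_sub, h1,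
      reassoc_of% h.comp_eq_zero]
    simp
  · rintro ⟨Q, a, b, hQ, rfl⟩
    obtain ⟨a', rfl⟩ := ht.exists_hom_extension i h.1 a
    obtain ⟨c, hc⟩ := h.exists_desc (w - a' ≫ b ≫ i) (by simp [h1, Preadditive.comp_sub])
    refine ⟨P, c, p, hP, ?_⟩
    have : Epi p := h.epi
    rw [← cancel_epi p, reassoc_of% hc, h2, Preadditive.sub_comp, Category.assoc, Category.assoc,
      h.comp_eq_zero]
    simp

lemma IsShortExact.exists_endRel_left (ht : IsSymmetrizing t) {X P Z : FGModuleCat.{v} A}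
    {i : Z ⟶ P} {p : P ⟶ X} (h : IsShortExact i p) [Module.Projective A P] (g : Z ⟶ Z) :
    ∃ f : X ⟶ X, EndRel i p f g := by
  obtain ⟨w, hw⟩ := ht.exists_hom_extension i h.1 (g ≫ i)
  obtain ⟨f, hf⟩ := h.exists_desc (w ≫ p) (by rw [reassoc_of% hw, h.comp_eq_zero]; simp)
  exact ⟨f, w, hw, hf⟩

lemma IsShortExact.exists_endRel_right {X P Z : FGModuleCat.{v} A}
    {i : Z ⟶ P} {p : P ⟶ X} (h : IsShortExact i p) [Module.Projective A P] (f : X ⟶ X) :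
    ∃ g : Z ⟶ Z, EndRel i p f g := by
  obtain ⟨w, hw⟩ := exists_lift_of_projective p h.2.2 (p ≫ f)
  obtain ⟨g, hg⟩ := h.exists_lift (i ≫ w) (by
    rw [Category.assoc, hw, reassoc_of% h.comp_eq_zero]; simp)
  exact ⟨g, w, hg.symm, hw.symm⟩

/-- `EndRel` is total on both sides and respects composition, differences and stable vanishing, so
idempotents correspond without making `Ω` a functor. -/
lemma IsShortExact.hasTrivialIdempotents_iff (ht : IsSymmetrizing t) {X P Z : FGModuleCat.{v} A}
    {i : Z ⟶ P} {p : P ⟶ X} (h : IsShortExact i p) [Module.Projective A P] :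
    HasTrivialIdempotents ((toStMod A).obj X) ↔ HasTrivialIdempotents ((toStMod A).obj Z) := by
  have key : ∀ {f : X ⟶ X} {g : Z ⟶ Z}, EndRel i p f g →
      (((toStMod A).map f ≫ (toStMod A).map f = (toStMod A).map f ↔
        (toStMod A).map g ≫ (toStMod A).map g = (toStMod A).map g) ∧
      (((toStMod A).map f = 0 ∨ (toStMod A).map f = 𝟙 _) ↔
        ((toStMod A).map g = 0 ∨ (toStMod A).map g = 𝟙 _))) := by
    intro f g hfg
    have h1 := h.map_eq_zero_iff ht hfg
    have h2 := h.map_eq_zero_iff ht ((hfg.comp hfg).sub hfg)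
    have h3 := h.map_eq_zero_iff ht (hfg.sub (EndRel.id i p))
    simp only [Functor.map_sub, Functor.map_comp, (toStMod A).map_id, sub_eq_zero] at h2 h3
    exact ⟨h2, or_congr h1 h3⟩
  constructor
  · intro hX e he
    obtain ⟨g, rfl⟩ := (toStMod A).map_surjective e
    obtain ⟨f, hfg⟩ := h.exists_endRel_left ht g
    exact (key hfg).2.mp (hX _ ((key hfg).1.mpr he))
  · intro hZ e he
    obtain ⟨f, rfl⟩ := (toStMod A).map_surjective e
    obtain ⟨g, hfg⟩ := h.exists_endRel_right f
    exact (key hfg).2.mpr (hZ _ ((key hfg).1.mp he))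

end Transfer

/-! ### Thick subcategories, sums of suspensions, decompositions. -/

section Thick

variable {k : Type u} {A : Type v} [Field k] [Ring A] [Algebra k A] [Module.Finite k A]
variable {t : A →ₗ[k] k}

lemma isShortExact_syzygy (X : FGModuleCat.{v} A) :
    IsShortExact (X := syzygy k X) (Y := proj X)
      (homMk (LinearMap.ker (projMap X).hom.hom).subtype) (projMap X) :=
  ⟨Subtype.val_injective, LinearMap.exact_subtype_ker_map _,
    (exists_projective_cover X).choose_spec.choose_spec.2⟩

lemma isShortExact_cosyzygy (X : FGModuleCat.{v} A) :
    IsShortExact (injMap k X) (cosyzygyMap k X) :=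
  ⟨(exists_injective_embedding k X).choose_spec.choose_spec.2,
    LinearMap.exact_map_mkQ_range _, Submodule.mkQ_surjective _⟩

lemma projective_proj (X : FGModuleCat.{v} A) : Module.Projective A (proj X) :=
  (exists_projective_cover X).choose_spec.choose_spec.1

lemma injective_inj (X : FGModuleCat.{v} A) : Module.Injective A (inj k X) :=
  (exists_injective_embedding k X).choose_spec.choose_spec.1

lemma IsSymmetrizing.projective_inj (ht : IsSymmetrizing t) (X : FGModuleCat.{v} A) :
    Module.Projective A (inj k X) :=
  haveI := injective_inj (k := k) X
  ht.projective_of_injective _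

/-- Injectivity of `inj k X` extends `injMap k X` over `Y`; the induced map on cokernels is the
connecting map. -/
lemma IsShortExact.exists_isExactTriangle {X Y Z : FGModuleCat.{v} A} {i : X ⟶ Y} {p : Y ⟶ Z}
    (h : IsShortExact i p) :
    ∃ d : Z ⟶ cosyzygy k X, IsExactTriangle k (X := (toStMod A).obj X) ((toStMod A).map i)
      ((toStMod A).map p) ((toStMod A).map d) := by
  obtain ⟨s, hs⟩ := (injective_inj (k := k) X).out i.hom.hom h.1 (injMap k X).hom.hom
  have hs' : i ≫ homMk s = injMap k X := FGModuleCat.hom_ext (LinearMap.ext hs)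
  obtain ⟨d, hd⟩ := h.exists_desc (homMk s ≫ cosyzygyMap k X) (by
    rw [reassoc_of% hs', (isShortExact_cosyzygy X).comp_eq_zero])
  exact ⟨d, Y, Z, i, p, homMk s, d, Iso.refl _, Iso.refl _, h, hs', hd,
    Category.comp_id _, by rw [Iso.refl_hom, Iso.refl_hom, Category.comp_id, Category.id_comp],
    (Category.id_comp _).symm⟩

section IsThick

variable {P : ObjectProperty (StMod A)} {X Y Z : FGModuleCat.{v} A} {i : X ⟶ Y} {p : Y ⟶ Z}

lemma IsThick.of_iso (hP : IsThick k P) {U V : StMod A} (e : U ≅ V) (hU : P U) : P V :=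
  hP.retract.of_retract e.symm.retract hU

lemma IsThick.of_isShortExact₁ (hP : IsThick k P) (h : IsShortExact i p)
    (hY : P ((toStMod A).obj Y)) (hZ : P ((toStMod A).obj Z)) : P ((toStMod A).obj X) := by
  obtain ⟨d, hd⟩ := h.exists_isExactTriangle (k := k)
  exact hP.triangle₁ _ _ _ hd hY hZ

lemma IsThick.of_isShortExact₂ (hP : IsThick k P) (h : IsShortExact i p)
    (hX : P ((toStMod A).obj X)) (hZ : P ((toStMod A).obj Z)) : P ((toStMod A).obj Y) := by
  obtain ⟨d, hd⟩ := h.exists_isExactTriangle (k := k)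
  exact hP.triangle₂ _ _ _ hd hX hZ

lemma IsThick.of_isShortExact₃ (hP : IsThick k P) (h : IsShortExact i p)
    (hX : P ((toStMod A).obj X)) (hY : P ((toStMod A).obj Y)) : P ((toStMod A).obj Z) := by
  obtain ⟨d, hd⟩ := h.exists_isExactTriangle (k := k)
  exact hP.triangle₃ _ _ _ hd hX hY

/-- A zero object is a retract of any object. `U` is needed because the empty property also
satisfies `IsThick`. -/
lemma IsThick.of_projective (hP : IsThick k P) {U : StMod A} (hU : P U) (X : FGModuleCat.{v} A)
    [h : Module.Projective A X] : P ((toStMod A).obj X) :=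
  hP.retract.of_retract (((isZero_toStMod_iff X).mpr h).retract U) hU

lemma IsThick.pi (hP : IsThick k P) {U : StMod A} (hU : P U) {m : ℕ}
    (F : Fin m → FGModuleCat.{v} A) (hF : ∀ j, P ((toStMod A).obj (F j))) :
    P ((toStMod A).obj (FGModuleCat.of A (∀ j, F j))) := by
  induction m with
  | zero =>
    haveI : Subsingleton (FGModuleCat.of A (∀ j, F j)) :=
      inferInstanceAs (Subsingleton (∀ j : Fin 0, F j))
    exact hP.of_projective hU _
  | succ m ih =>
    let i : F 0 ⟶ FGModuleCat.of A (∀ j, F j) := homMk (LinearMap.single A (fun j => F j) 0)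
    let p : FGModuleCat.of A (∀ j, F j) ⟶ FGModuleCat.of A (∀ j : Fin m, F j.succ) :=
      homMk (LinearMap.pi fun j => LinearMap.proj j.succ)
    have h : IsShortExact i p := by
      refine ⟨Pi.single_injective (M := fun j => F j) 0, fun y => ⟨fun hy => ⟨y 0, ?_⟩, ?_⟩,
        fun z => ⟨?_, ?_⟩⟩
      · refine funext fun j => ?_
        refine Fin.cases ?_ (fun j => ?_) j
        · exact Pi.single_eq_same (M := fun j => F j) (0 : Fin (m + 1)) (y 0)
        · exact (Pi.single_eq_of_ne (M := fun j => F j) (Fin.succ_ne_zero j) (y 0)).trans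
            (congrFun hy j).symm
      · rintro ⟨x, rfl⟩
        exact funext fun j => Pi.single_eq_of_ne (M := fun j => F j) (Fin.succ_ne_zero j) x
      · exact Fin.cons (α := fun j => F j) 0 z
      · rfl
    exact hP.of_isShortExact₂ h (hF 0) (ih _ fun j => hF j.succ)

lemma IsThick.syzygy (hP : IsThick k P) (hX : P ((toStMod A).obj X)) :
    P ((toStMod A).obj (syzygy k X)) :=
  haveI := projective_proj X
  hP.of_isShortExact₁ (isShortExact_syzygy X) (hP.of_projective hX _) hX

lemma IsThick.cosyzygy (hP : IsThick k P) (ht : IsSymmetrizing t) (hX : P ((toStMod A).obj X)) :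
    P ((toStMod A).obj (cosyzygy k X)) :=
  haveI := ht.projective_inj X
  hP.of_isShortExact₃ (isShortExact_cosyzygy X) hX (hP.of_projective hX _)

end IsThick

/-- A property of modules stable under `Ω` and `Ω⁻¹` passes to all suspensions. -/
lemma omega_induction (Q : FGModuleCat.{v} A → Prop) (hs : ∀ X, Q X → Q (syzygy k X))
    (hc : ∀ X, Q X → Q (cosyzygy k X)) {L : FGModuleCat.{v} A} (hL : Q L) (n : ℤ) :
    Q (omega k n L) := by
  have key : ∀ (F : FGModuleCat.{v} A → FGModuleCat.{v} A), (∀ X, Q X → Q (F X)) →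
      ∀ n : ℕ, Q (F^[n] L) := fun F hF n => by
    induction n with
    | zero => exact hL
    | succ n ih => rw [Function.iterate_succ_apply']; exact hF _ ih
  cases n with
  | ofNat n => exact key _ hs n
  | negSucc n => exact key _ hc (n + 1)

lemma hasTrivialIdempotents_omega (ht : IsSymmetrizing t) {L : FGModuleCat.{v} A}
    (hL : HasTrivialIdempotents ((toStMod A).obj L)) (n : ℤ) :
    HasTrivialIdempotents ((toStMod A).obj (omega k n L)) := by
  refine omega_induction (fun X => HasTrivialIdempotents ((toStMod A).obj X)) (fun X hX => ?_)
    (fun X hX => ?_) hL n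
  · haveI := projective_proj X
    exact ((isShortExact_syzygy (k := k) X).hasTrivialIdempotents_iff ht).mp hX
  · haveI := ht.projective_inj X
    exact ((isShortExact_cosyzygy (k := k) X).hasTrivialIdempotents_iff ht).mpr hX

lemma isThick_thick (L : FGModuleCat.{v} A) : IsThick k (thick k L) where
  retract := ⟨fun r h P hP hL => hP.retract.of_retract r (h P hP hL)⟩
  triangle₁ f g h hT hY hZ P hP hL := hP.triangle₁ f g h hT (hY P hP hL) (hZ P hP hL)
  triangle₂ f g h hT hX hZ P hP hL := hP.triangle₂ f g h hT (hX P hP hL) (hZ P hP hL)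
  triangle₃ f g h hT hX hY P hP hL := hP.triangle₃ f g h hT (hX P hP hL) (hY P hP hL)

lemma thick_self (L : FGModuleCat.{v} A) : thick k L ((toStMod A).obj L) := fun _ _ h => h

lemma thick_omega (ht : IsSymmetrizing t) (L : FGModuleCat.{v} A) (n : ℤ) :
    thick k L ((toStMod A).obj (omega k n L)) :=
  omega_induction (fun X => thick k L ((toStMod A).obj X)) (fun _ h => (isThick_thick L).syzygy h)
    (fun _ h => (isThick_thick L).cosyzygy ht h) (thick_self L) n

/-- An object is a finite direct sum of suspensions of `L`. -/
def IsSumOmega (k : Type u) {A : Type v} [Field k] [Ring A] [Algebra k A] [Module.Finite k A]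
    (L : FGModuleCat.{v} A) (X : StMod A) : Prop :=
  ∃ (m : ℕ) (n : Fin m → ℤ), Nonempty (X ≅ (toStMod A).obj (sumOmega k L n))

lemma IsSumOmega.thick (ht : IsSymmetrizing t) {L : FGModuleCat.{v} A} {X : StMod A}
    (h : IsSumOmega k L X) : thick k L X := by
  obtain ⟨m, n, ⟨e⟩⟩ := h
  exact (isThick_thick L).of_iso e.symm
    ((isThick_thick L).pi (thick_self L) _ fun j => thick_omega ht L (n j))

lemma IsSumOmega.of_iso {L : FGModuleCat.{v} A} {X Y : StMod A} (e : X ≅ Y)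
    (h : IsSumOmega k L Y) : IsSumOmega k L X := by
  obtain ⟨m, n, ⟨e'⟩⟩ := h
  exact ⟨m, n, ⟨e ≪≫ e'⟩⟩

lemma isSumOmega_of_projective (L X : FGModuleCat.{v} A) [h : Module.Projective A X] :
    IsSumOmega k L ((toStMod A).obj X) := by
  refine ⟨0, Fin.elim0, ⟨((isZero_toStMod_iff X).mpr h).iso ((isZero_toStMod_iff _).mpr ?_)⟩⟩
  haveI : Subsingleton (sumOmega k L Fin.elim0) :=
    inferInstanceAs (Subsingleton (∀ j : Fin 0, omega k (Fin.elim0 j) L))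
  infer_instance

lemma isSumOmega_omega (L : FGModuleCat.{v} A) (n : ℤ) :
    IsSumOmega k L ((toStMod A).obj (omega k n L)) :=
  ⟨1, fun _ => n, ⟨(toStMod A).mapIso (isoMk (Y := sumOmega k L fun _ : Fin 1 => n)
    (LinearEquiv.funUnique (Fin 1) A (omega k n L)).symm)⟩⟩

/-- The direct sum of isomorphisms in the stable category. -/
lemma nonempty_iso_prod {X₁ X₂ Y₁ Y₂ : FGModuleCat.{v} A}
    (e₁ : (toStMod A).obj X₁ ≅ (toStMod A).obj Y₁) (e₂ : (toStMod A).obj X₂ ≅ (toStMod A).obj Y₂) :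
    Nonempty ((toStMod A).obj (FGModuleCat.of A (X₁ × X₂)) ≅
      (toStMod A).obj (FGModuleCat.of A (Y₁ × Y₂))) := by
  obtain ⟨f₁, hf₁⟩ := (toStMod A).map_surjective e₁.hom
  obtain ⟨g₁, hg₁⟩ := (toStMod A).map_surjective e₁.inv
  obtain ⟨f₂, hf₂⟩ := (toStMod A).map_surjective e₂.hom
  obtain ⟨g₂, hg₂⟩ := (toStMod A).map_surjective e₂.inv
  -- `a₁` and `a₂` are identities only stably, so their product is first expanded through
  -- projections and inclusions.
  have key : ∀ {U₁ U₂ : FGModuleCat.{v} A} (a₁ : U₁ ⟶ U₁) (a₂ : U₂ ⟶ U₂),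
      (toStMod A).map a₁ = 𝟙 _ → (toStMod A).map a₂ = 𝟙 _ →
      (toStMod A).map (X := FGModuleCat.of A (U₁ × U₂)) (Y := FGModuleCat.of A (U₁ × U₂))
        (homMk (a₁.hom.hom.prodMap a₂.hom.hom)) = 𝟙 _ := by
    intro U₁ U₂ a₁ a₂ h₁ h₂
    let W := FGModuleCat.of A (U₁ × U₂)
    let p₁ : W ⟶ U₁ := homMk (LinearMap.fst A U₁ U₂)
    let p₂ : W ⟶ U₂ := homMk (LinearMap.snd A U₁ U₂)
    let i₁ : U₁ ⟶ W := homMk (LinearMap.inl A U₁ U₂)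
    let i₂ : U₂ ⟶ W := homMk (LinearMap.inr A U₁ U₂)
    have h : (homMk (a₁.hom.hom.prodMap a₂.hom.hom) : W ⟶ W) = p₁ ≫ a₁ ≫ i₁ + p₂ ≫ a₂ ≫ i₂ :=
      FGModuleCat.hom_ext (LinearMap.ext fun x =>
        Prod.ext (add_zero _).symm (zero_add _).symm)
    have h' : 𝟙 W = p₁ ≫ i₁ + p₂ ≫ i₂ :=
      FGModuleCat.hom_ext (LinearMap.ext fun x =>
        Prod.ext (add_zero _).symm (zero_add _).symm)
    rw [h, ← (toStMod A).map_id, h']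
    simp only [Functor.map_add, Functor.map_comp, h₁, h₂, Category.id_comp]
  refine ⟨⟨(toStMod A).map (homMk (f₁.hom.hom.prodMap f₂.hom.hom)),
    (toStMod A).map (homMk (g₁.hom.hom.prodMap g₂.hom.hom)), ?_, ?_⟩⟩
  · refine (((toStMod A).map_comp _ _).symm).trans (key (f₁ ≫ g₁) (f₂ ≫ g₂) ?_ ?_) <;>
    simp [*]
  · refine (((toStMod A).map_comp _ _).symm).trans (key (g₁ ≫ f₁) (g₂ ≫ f₂) ?_ ?_) <;>
    simp [*]

lemma IsSumOmega.prod {L X₁ X₂ : FGModuleCat.{v} A} (h₁ : IsSumOmega k L ((toStMod A).obj X₁))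
    (h₂ : IsSumOmega k L ((toStMod A).obj X₂)) :
    IsSumOmega k L ((toStMod A).obj (FGModuleCat.of A (X₁ × X₂))) := by
  obtain ⟨m₁, n₁, ⟨e₁⟩⟩ := h₁
  obtain ⟨m₂, n₂, ⟨e₂⟩⟩ := h₂
  obtain ⟨e⟩ := nonempty_iso_prod e₁ e₂
  let n := Sum.elim n₁ n₂
  let e' : (sumOmega k L n₁ × sumOmega k L n₂) ≃ₗ[A] sumOmega k L (n ∘ finSumFinEquiv.symm) :=
    (LinearEquiv.sumPiEquivProdPi A (Fin m₁) (Fin m₂) fun s => omega k (n s) L).symm.trans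
      (LinearEquiv.piCongrLeft' A (fun s => omega k (n s) L) finSumFinEquiv)
  exact ⟨m₁ + m₂, n ∘ finSumFinEquiv.symm,
    ⟨e ≪≫ (toStMod A).mapIso (isoMk (X := FGModuleCat.of A (sumOmega k L n₁ × sumOmega k L n₂)) e')⟩⟩

/-- The decomposition into indecomposables: a property of modules that holds for indecomposable
modules and passes to direct sums holds for all finitely generated modules in a class closed under
direct summands. -/
lemma decomposition_induction [IsNoetherianRing A] [IsArtinianRing A] (S Q : FGModuleCat.{v} A → Prop)
    (hS : ∀ X Y, S Y → ∀ (i : X ⟶ Y) (r : Y ⟶ X), i ≫ r = 𝟙 X → S X)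
    (hind : ∀ X : FGModuleCat.{v} A, S X → IsIndecomposable A X → Q X)
    (hprod : ∀ X Y Z : FGModuleCat.{v} A, ((X × Y) ≃ₗ[A] Z) → Q X → Q Y → Q Z)
    (X : FGModuleCat.{v} A) (hX : S X) : Q X := by
  obtain ⟨N, hN⟩ : ∃ N : ℕ, Module.length A X ≤ N := by
    have : Module.length A X ≠ ⊤ := Module.length_ne_top
    exact ⟨(Module.length A X).toNat, (ENat.natCast_toNat this).ge⟩
  induction N generalizing X with
  | zero =>
    have : Subsingleton X := Module.length_eq_zero_iff.mp (by simpa using hN)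
    -- The zero module satisfies `IsIndecomposable`, so `hind` covers the base case.
    exact hind X hX fun p q _ => Or.inl (Subsingleton.elim _ _)
  | succ N ih =>
    by_cases h : IsIndecomposable A X
    · exact hind X hX h
    · unfold IsIndecomposable at h
      push Not at h
      obtain ⟨p, q, hpq, hp, hq⟩ := h
      have hlen : Module.length A p + Module.length A q ≤ N + 1 := by
        rw [← Module.length_prod, (Submodule.prodEquivOfIsCompl p q hpq).length_eq]
        exact hN
      have h1 : ∀ r : Submodule A X, r ≠ ⊥ → 1 ≤ Module.length A r := fun r hr => by
        haveI := Submodule.nontrivial_iff_ne_bot.mpr hr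
        exact Order.one_le_iff_pos.mpr Module.length_pos
      have key : ∀ p q : Submodule A X, IsCompl p q → S (FGModuleCat.of A p) := fun p q hpq =>
        hS _ X hX (homMk p.subtype) (homMk (Submodule.projectionOnto p q hpq))
          (FGModuleCat.hom_ext (LinearMap.ext fun x =>
            Submodule.projectionOnto_apply_left hpq x))
      refine hprod (FGModuleCat.of A p) (FGModuleCat.of A q) X
        (Submodule.prodEquivOfIsCompl p q hpq) (ih _ (key p q hpq) ?_)
        (ih _ (key q p hpq.symm) ?_)
      · exact (ENat.add_le_add_iff_right ENat.one_ne_top).mp ((add_le_add_right (h1 q hq) _).trans hlen)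
      · exact (ENat.add_le_add_iff_right ENat.one_ne_top).mp
          ((add_le_add_right (h1 p hp) _).trans ((add_comm _ _).trans_le hlen))

end Thick

/-! ### The two implications. -/

section Main

variable {k : Type u} {A : Type v} [Field k] [Ring A] [Algebra k A] [Module.Finite k A]
variable {t : A →ₗ[k] k}

/-- A nonprojective indecomposable module is the source of a stably nonzero map out of which
every composite with a map that is not a split epimorphism vanishes stably. Its target is a
syzygy. -/
lemma IsSymmetrizing.exists_syzygy_map (ht : IsSymmetrizing t) {M : FGModuleCat.{v} A}
    (hM : IsIndecomposable A M) (hp : ¬ Module.Projective A M) :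
    ∃ (K P : FGModuleCat.{v} A) (i : K ⟶ P) (p : P ⟶ M) (e : M ⟶ K), IsShortExact i p ∧
      Module.Projective A P ∧ (toStMod A).map e ≠ 0 ∧
      ∀ (N : FGModuleCat.{v} A) (h : N ⟶ M),
        (∀ f : M ⟶ N, ¬ IsUnit (h.hom.hom ∘ₗ f.hom.hom : Module.End A M)) →
        (toStMod A).map (h ≫ e) = 0 := by
  obtain ⟨n, π, g, hπ, hπg, hg, hgh⟩ := ht.exists_almost_vanishing hM hp
  let P := FGModuleCat.of A (Fin n → A)
  let p : P ⟶ M := homMk π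
  haveI : Module.Finite A (LinearMap.ker π) := finite_ker k p
  let K := FGModuleCat.of A (LinearMap.ker π)
  let i : K ⟶ P := homMk (LinearMap.ker π).subtype
  have hip : IsShortExact i p := ⟨Subtype.val_injective, LinearMap.exact_subtype_ker_map _, hπ⟩
  -- Since `π ∘ₗ g = 0`, `g` corestricts to the syzygy.
  obtain ⟨e, he⟩ := hip.exists_lift (homMk g) (FGModuleCat.hom_ext hπg)
  have he' : g = i.hom.hom ∘ₗ e.hom.hom := congrArg (fun q => q.hom.hom) he.symm
  refine ⟨K, P, i, p, e, hip, (inferInstance : Module.Projective A (Fin n → A)), fun h0 => ?_,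
    fun N h hh => ?_⟩
  · obtain ⟨q, a, b, hab⟩ := exists_free_factorization h0
    refine hg q a (i.hom.hom ∘ₗ b) (LinearMap.ext fun x => Subtype.prop (b x : LinearMap.ker π)) ?_
    rw [he', hab, LinearMap.comp_assoc]
  · obtain ⟨m, w, d, hd, hw⟩ := hgh N h.hom.hom fun f => hh (homMk f)
    let D : FGModuleCat.of A (Fin m → A) ⟶ P := homMk d
    obtain ⟨d', hd'⟩ := hip.exists_lift D (FGModuleCat.hom_ext hd)
    refine toStMod_map_eq_zero _ w d'.hom.hom ?_
    have hm := hip.mono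
    have : h ≫ e = (homMk w : N ⟶ FGModuleCat.of A (Fin m → A)) ≫ d' := by
      rw [← cancel_mono i, Category.assoc, he, Category.assoc, hd']
      exact FGModuleCat.hom_ext hw
    rw [this]
    rfl

lemma isSumOmega_of_isIndecomposable (ht : IsSymmetrizing t) {L : FGModuleCat.{v} A}
    (hL : HasTrivialIdempotents ((toStMod A).obj L)) (hf : (stableHom k L).Faithful)
    (X : FGModuleCat.{v} A) (hX : thick k L ((toStMod A).obj X)) (hi : IsIndecomposable A X) :
    IsSumOmega k L ((toStMod A).obj X) := by
  by_cases hp : Module.Projective A X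
  · exact isSumOmega_of_projective L X
  by_contra hsum
  obtain ⟨K, P, i, p, e, hip, hP, he, hvan⟩ := ht.exists_syzygy_map hi hp
  -- Faithfulness concerns only maps inside the thick subcategory, so the target of `e` must lie
  -- there too.
  have hK : thick k L ((toStMod A).obj K) :=
    (isThick_thick L).of_isShortExact₁ hip ((isThick_thick L).of_projective (thick_self L) P) hX
  let ε : (⟨_, hX⟩ : (thick k L).FullSubcategory) ⟶ ⟨_, hK⟩ :=
    ObjectProperty.homMk ((toStMod A).map e)
  let ζ : (⟨_, hX⟩ : (thick k L).FullSubcategory) ⟶ ⟨_, hK⟩ :=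
    ObjectProperty.homMk 0
  have hεζ : ε = ζ := by
    refine hf.map_injective (funext fun n => ?_)
    refine AddCommGrpCat.hom_ext (AddMonoidHom.ext fun x => ?_)
    change x ≫ (toStMod A).map e = x ≫ 0
    obtain ⟨h, rfl⟩ := (toStMod A).map_surjective x
    rw [Limits.comp_zero, ← Functor.map_comp]
    -- A unit `h ∘ f` would make `X` a retract of `Ωⁿ L`, hence isomorphic to it.
    refine hvan _ h fun f hu => hsum ?_
    obtain ⟨g, hg⟩ := hu.exists_left_inv
    have hr : f ≫ h ≫ homMk g = 𝟙 X := FGModuleCat.hom_ext hg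
    obtain ⟨e'⟩ := (hasTrivialIdempotents_omega ht hL n).iso_of_retract
      (X := (toStMod A).obj X) ⟨(toStMod A).map f, (toStMod A).map (h ≫ homMk g), by
        rw [← Functor.map_comp, hr, (toStMod A).map_id]⟩ (by rwa [isZero_toStMod_iff])
    exact (isSumOmega_omega L n).of_iso e'
  exact he (congrArg (fun q => q.hom) hεζ)

lemma isSumOmega_of_thick (ht : IsSymmetrizing t) {L : FGModuleCat.{v} A}
    (hL : HasTrivialIdempotents ((toStMod A).obj L)) (hf : (stableHom k L).Faithful)
    (X : FGModuleCat.{v} A) (hX : thick k L ((toStMod A).obj X)) :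
    IsSumOmega k L ((toStMod A).obj X) := by
  haveI : IsNoetherianRing A := isNoetherian_of_tower k inferInstance
  haveI : IsArtinianRing A := isArtinian_of_tower k inferInstance
  refine decomposition_induction (fun X => thick k L ((toStMod A).obj X))
    (fun X => IsSumOmega k L ((toStMod A).obj X)) (fun X Y hY i r hir => ?_)
    (isSumOmega_of_isIndecomposable ht hL hf) (fun X Y Z e hX hY => ?_) X hX
  · exact (isThick_thick L).retract.of_retract ⟨(toStMod A).map i, (toStMod A).map r, by
      rw [← Functor.map_comp, hir, (toStMod A).map_id]⟩ hY
  · exact (hX.prod hY).of_iso ((toStMod A).mapIso (isoMk (Y := FGModuleCat.of A (X × Y)) e.symm))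

/-- The identity of the sum is `∑ j, p j ≫ i j`, so testing on the inclusions of the summands
suffices. -/
lemma eq_of_isSumOmega {L : FGModuleCat.{v} A} {X Y : StMod A} (hX : IsSumOmega k L X)
    {f g : X ⟶ Y}
    (h : ∀ (n : ℤ) (x : (toStMod A).obj (omega k n L) ⟶ X), x ≫ f = x ≫ g) : f = g := by
  obtain ⟨m, n, ⟨e⟩⟩ := hX
  let i (j : Fin m) : omega k (n j) L ⟶ sumOmega k L n :=
    homMk (LinearMap.single A (fun j => omega k (n j) L) j)
  let p (j : Fin m) : sumOmega k L n ⟶ omega k (n j) L := homMk (LinearMap.proj j)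
  have hid : 𝟙 (sumOmega k L n) = ∑ j, p j ≫ i j := by
    let φ : (sumOmega k L n ⟶ sumOmega k L n) →+ (sumOmega k L n →ₗ[A] sumOmega k L n) :=
      AddMonoidHom.mk' (fun f => f.hom.hom) fun _ _ => rfl
    refine FGModuleCat.hom_ext (LinearMap.ext fun x => ?_)
    change x = φ (∑ j, p j ≫ i j) x
    rw [map_sum, LinearMap.sum_apply]
    exact (Finset.univ_sum_single (M := fun j => omega k (n j) L) x).symm
  rw [← cancel_epi e.inv]
  have h1 := (toStMod A).congr_map hid
  rw [(toStMod A).map_id, Functor.map_sum] at h1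
  rw [← Category.id_comp (e.inv ≫ f), ← Category.id_comp (e.inv ≫ g), h1, Preadditive.sum_comp,
    Preadditive.sum_comp]
  refine Finset.sum_congr rfl fun j _ => ?_
  have := h (n j) ((toStMod A).map (i j) ≫ e.inv)
  simp only [Functor.map_comp, Category.assoc] at this ⊢
  rw [this]

end Main

end StableModule

end

theorem theorem4p1 {k : Type u} {A : Type v} [Field k] [Ring A] [Algebra k A] [Module.Finite k A]
    (hA : StableModule.IsSymmetricAlg k A) (L : FGModuleCat.{v} A)
    (hproj : ¬ Module.Projective A L) (hind : Indecomposable L.obj) :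
    (StableModule.stableHom k L).Faithful ↔
      ∀ X : StableModule.StMod A, StableModule.thick k L X ↔
        ∃ (m : ℕ) (n : Fin m → ℤ),
          Nonempty (X ≅ (StableModule.toStMod A).obj (StableModule.sumOmega k L n)) := by
  obtain ⟨t, hsymm, hnondeg⟩ := hA
  have ht : StableModule.IsSymmetrizing t := ⟨hsymm, hnondeg⟩
  haveI : IsNoetherianRing A := isNoetherian_of_tower k inferInstance
  haveI : IsArtinianRing A := isArtinian_of_tower k inferInstance
  have hL := StableModule.hasTrivialIdempotents_of_isIndecomposable
    (StableModule.isIndecomposable_of_indecomposable hind)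
  refine ⟨fun hf X => ⟨fun hX => StableModule.isSumOmega_of_thick ht hL hf X.as hX,
    fun hX => StableModule.IsSumOmega.thick ht hX⟩, fun h => ⟨fun {X Y f g} hfg => ?_⟩⟩
  refine ObjectProperty.hom_ext _ (StableModule.eq_of_isSumOmega ((h X.obj).mp X.property)
    fun n x => ?_)
  exact congrArg (fun q => (q n).hom x) hfg
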